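/- **Setting.** Let $\mathcal X=\mathbb N$, $\mathcal Y=\{0,1\}$, let $\Phi=\{0,1\}^{\mathcal X}$ be the set of all Boolean features, and let $H=\{(2,0),(1,1)\}$. *Teachers.* A teacher is a pair $T=(\ell,\psi)$ with $\ell:\mathcal X\to\mathcal Y$ and $\psi:\mathcal X\times\mathcal X\to\Phi\cup\{\bot\}$ such that, whenever $\ell(x)\ne\ell(\hat x)$, $\psi(x,\hat x)$ is a feature satisfied by $x$ and not by $\hat x$. For a set $\mathcal T$ of teachers (a teacher class), $\mathcal T_H$ is the set of those $(\ell,\psi)\in\mathcal T$ with $\ell(x)=y$ for all $(x,y)\in H$. *DFF dimension.* A DFF tree is a rooted tree with nodes $\langle y,\phi,x\rangle$ (entries possibly $\bot$) and edges labeled by pairs $(\hat x,\hat y)\in\mathcal X\times\mathcal Y$, with $y=\phi=\bot$ at the root, $x=\bot$ exactly at the leaves, and $\phi\neq\bot$ at each non-root node whose $y$ differs from the label $\hat y$ of its incoming edge. The labeled examples of a path are the pairs $(x,y)$ with $x$ the example of a node of the path and $y$ the label of the next node. The tree is shattered by $\mathcal T,H$ if: (1) for every node $\langle y,\phi,x\rangle$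 with incoming edge $(\hat x,\hat y)$, $y\ne\hat y$; (2) the outgoing edges of each non-leaf node are labeled by exactly the pairs in $H$ and the labeled examples of the path from the root to that node; (3) for every path from the root to a leaf there is $(\ell,\psi)\in\mathcal T_H$ such that, for each edge $\langle\cdot,\cdot,x\rangle\to\langle y,\phi,\cdot\rangle$ of the path with label $(\hat x,\hat y)$, $\ell(x)=y$ and $\psi(x,\hat x)=\phi$ whenever $y\ne\hat y$; (4) all paths from the root to a leaf have the same length. $\mathrm{DFFdim}(\mathcal T,H)$ is the maximal height of a DFF tree shattered by $\mathcal T,H$. *Interaction.* In round $t$ an adaptive adversary chooses $x_t\in\mathcal X$, $y_t\in\mathcal Y$ and $\psi_t:\mathcal X\times\mathcal X\to\Phi$ depending on the previous rounds. Then the algorithm $\mathcal A$ draws $(\hat x_t,\hat y_t)$ from a distribution depending on the previous rounds and $x_t$, supported on $H\cup\{(x_s,y_s):s<t\}$. If $\hat y_t\ne y_t$ (a mistake), then $\phi_t=\psi_t(x_t,\hat x_t)$ is revealed, otherwise $\phi_t=\bot$; $y_t$ is revealed in either case. An $L$-round sequence is $k$-consistent with $(\ell,\psi)$ if for all but at most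 $k$ rounds $\ell(x_t)=y_t$, and $\psi(x_t,\hat x_t)=\phi_t$ if $\hat y_t\ne y_t$. $M^L_k(\mathcal A,\mathcal T,H)$ is the supremum of the expected number of mistakes of $\mathcal A$ in $L$ rounds over all adversaries that, against $\mathcal A$, generate with probability $1$ a sequence that is $k$-consistent with some $T\in\mathcal T$. A family $(\mathcal A_{L,k})$ of algorithms is no-regret for $\mathcal T$ if for every $\varepsilon>0$ and all large enough $L$, $M^L_k(\mathcal A_{L,k},\mathcal T,H)\le k+\varepsilon L$ for all $k$. *Shamir classes.* Let $m\ge1$. For $i\ge 1$ let $\mathcal X_i=\{2^i,\dots,2^{i+1}-1\}$, let $\mathcal F_i$ be the set of all $f:\mathcal X\to\{0,1\}$ with $f(1)=1$ and $f(x)=0$ for $x\notin\mathcal X_i\cup\{1\}$, let $p_i\ge 2^{2^i}=|\mathcal F_i|$ be a prime and $b_i:\mathcal F_i\to\mathbb F_{p_i}$ an injection. For $c\in\mathbb F_{p_i}^m$ let $P'[c](z)=\sum_{j<m}c_jz^j\in\mathbb F_{p_i}$, and let $P[c](x)=2^{i+1}+P'[c](x-2^i+1)$, where residues are represented in $\{0,\dots,p_i-1\}$.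 For $f\in\mathcal F_i$ and $a:\mathcal X_i\times\{0,1\}\to\mathbb F_{p_i}^m$, let $\psi^f_a(x,\hat x)$ be the indicator of $\{x,P[a(\hat x,f(x))](x)\}$ if $x,\hat x\in\mathcal X_i$, and the indicator of $\{x\}$ otherwise. The Shamir class with threshold $m$ (for the given $p_i,b_i$) consists of all teachers $(f,\psi^f_a)$ with $i\ge1$, $f\in\mathcal F_i$ and $a$ such that $P'[a(\hat x,0)](0)=b_i(f)$ for every $\hat x\in\mathcal X_i$ with $f(\hat x)=1$. **Theorem.** Let $d\ge2$. There is a teacher class $\mathcal T^d$, which is a Shamir class with threshold $d-1$ for some choice of the $p_i$ and $b_i$, such that $\mathcal T^d_H\neq\emptyset$, $\mathrm{DFFdim}(\mathcal T^d,H)\le d$, and for all $k\ge1$, all $L\ge4(k+1)d$ and every (possibly randomized) algorithm $\mathcal A$, $$M^L_k(\mathcal A,\mathcal T^d,H)\ \ge\ (k+1)d-k-2 .$$ Consequently, if $d\ge3$, there is a constant $c>0$ such that for every large enough $L$ there is $k$ with $M^L_k(\mathcal A,\mathcal T^d,H)-k\ge cL$ for every algorithm $\mathcal A$; in particular, no family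 of algorithms is no-regret for $\mathcal T^d$. -/

import Mathlib

open Filter
open scoped ENNReal

/-! # Discriminative Feature Feedback (DFF)

`X` is the domain of examples, `Y` the label set, and the available features are all
Boolean functions `X → Bool`.  The null element `⊥` is `none`. -/

namespace DFF

/-- A teacher: a labeling function and a feature feedback function such that, whenever the labels
of `x` and `x'` differ, the feedback is a feature satisfied by `x` and not satisfied by `x'`. -/
structure Teacher (X Y : Type*) where
  label : X → Y
  feedback : X → X → Option (X → Bool)
  discriminates : ∀ x x', label x ≠ label x' →
    ∃ φ, feedback x x' = some φ ∧ φ x = true ∧ φ x' = false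

/-- The teachers of `𝒯` that are consistent with the history `H`. -/
def consistentTeachers {X Y : Type*} (𝒯 : Set (Teacher X Y)) (H : Set (X × Y)) :
    Set (Teacher X Y) :=
  {T ∈ 𝒯 | ∀ e ∈ H, T.label e.1 = e.2}

/-! ## DFF trees and the DFF dimension -/

/-- Rooted trees whose nodes carry a triple `⟨y, φ, x⟩` of possibly null values and whose edges are
labeled by pairs `(x', y')`.  `E` is the set of labels of the outgoing edges of the node. -/
inductive Tree (X Y : Type*)
  | node (y : Option Y) (φ : Option (X → Bool)) (x : Option X) (E : Set (X × Y))
      (child : E → Tree X Y)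

namespace Tree

variable {X Y : Type*}

/-- The label `y` at the root of `t`. -/
def rootLabel : Tree X Y → Option Y
  | node y _ _ _ _ => y

/-- The feature `φ` at the root of `t`. -/
def rootFeature : Tree X Y → Option (X → Bool)
  | node _ φ _ _ _ => φ

/-- The example `x` at the root of `t`. -/
def rootExample : Tree X Y → Option X
  | node _ _ x _ _ => x

/-- The labels of the edges that leave the root of `t`. -/
def rootEdges : Tree X Y → Set (X × Y)
  | node _ _ _ E _ => E

/-- `t` consists of a leaf only. -/
def IsLeaf (t : Tree X Y) : Prop := t.rootEdges = ∅

/-- The data seen along an edge of a tree: the example of the parent node, the label of the edge,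
and the label and the feature of the child node. -/
structure Step (X Y : Type*) where
  x : Option X
  edge : X × Y
  y : Option Y
  φ : Option (X → Bool)

/-- `Path t p v`: the steps `p` lead from the root of `t` to a node, and `v` is the subtree of `t`
that is rooted at this node. -/
inductive Path : Tree X Y → List (Step X Y) → Tree X Y → Prop
  | nil (t : Tree X Y) : Path t [] t
  | cons (y : Option Y) (φ : Option (X → Bool)) (x : Option X) (E : Set (X × Y))
      (child : E → Tree X Y) (e : E) (p : List (Step X Y)) (v : Tree X Y)
      (h : Path (child e) p v) :
      Path (node y φ x E child)
        (⟨x, e.1, (child e).rootLabel, (child e).rootFeature⟩ :: p) v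

/-- The defining conditions of a DFF tree. -/
structure IsDFFT (t : Tree X Y) : Prop where
  root_label : t.rootLabel = none
  root_feature : t.rootFeature = none
  leaf_iff : ∀ p v, Path t p v → (v.rootExample = none ↔ v.IsLeaf)
  feature_ne : ∀ p v, Path t p v → ∀ s ∈ p, s.y ≠ some s.edge.2 → s.φ ≠ none

/-- The labeled examples in a path. -/
def labeledExamples (p : List (Step X Y)) : Set (X × Y) :=
  {e | ∃ s ∈ p, s.x = some e.1 ∧ s.y = some e.2}

/-- The path `p` is consistent with the teacher `T`. -/
def PathConsistent (T : Teacher X Y) (p : List (Step X Y)) : Prop :=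
  ∀ s ∈ p, ∃ x, s.x = some x ∧ s.y = some (T.label x) ∧
    (s.y ≠ some s.edge.2 → T.feedback x s.edge.1 = s.φ)

/-- The DFF tree `t` is shattered by `𝒯` and `H`, and all its paths from the root to a leaf have
the same length `n`, so that `t` is complete of height `n`. -/
structure IsShattered (𝒯 : Set (Teacher X Y)) (H : Set (X × Y)) (n : ℕ) (t : Tree X Y) :
    Prop where
  isDFFT : t.IsDFFT
  label_ne : ∀ p v, Path t p v → ∀ s ∈ p, s.y ≠ some s.edge.2
  edges_eq : ∀ p v, Path t p v → ¬ v.IsLeaf → v.rootEdges = H ∪ labeledExamples p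
  consistent : ∀ p v, Path t p v → v.IsLeaf → ∃ T ∈ consistentTeachers 𝒯 H, PathConsistent T p
  complete : ∀ p v, Path t p v → v.IsLeaf → p.length = n

end Tree

/-- The DFF dimension: the maximal height of a shattered DFF tree (`⊤` if there is no maximum).
It is meant for non-empty `H` and for `𝒯` consistent with `H`. -/
noncomputable def DFFdim {X Y : Type*} (𝒯 : Set (Teacher X Y)) (H : Set (X × Y)) : ℕ∞ :=
  ⨆ (n : ℕ) (_ : ∃ t : Tree X Y, t.IsShattered 𝒯 H n), (n : ℕ∞)

/-! ## The interaction of a randomized algorithm with an adaptive adversary -/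

/-- The record of one round: the example `x`, its label `y`, the explanation `x'` and the
prediction `y'` of the algorithm, and the feature feedback `φ`. -/
structure Round (X Y : Type*) where
  x : X
  y : Y
  x' : X
  y' : Y
  φ : Option (X → Bool)

/-- A (possibly randomized) DFF algorithm for the history `H`.  Given the rounds that were played
so far (the most recent one first) and the next example, it draws an explanation and a predicted
label; the explanation was previously observed with the predicted label. -/
structure Algorithm {X Y : Type*} (H : Set (X × Y)) where
  act : List (Round X Y) → X → PMF (X × Y)
  legal : ∀ S x, ∀ e ∈ (act S x).support, e ∈ H ∨ ∃ r ∈ S, e = (r.x, r.y)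

/-- An adaptive adversary: it selects the next example, its label and the feature feedback
function, based on the rounds that were played so far. -/
def Adversary (X Y : Type*) : Type _ :=
  List (Round X Y) → X × Y × (X → X → (X → Bool))

section Run

variable {X Y : Type*} [DecidableEq Y] {H : Set (X × Y)}

/-- The record of a round, given the choice of the adversary and then that of the algorithm. -/
def playRound (v : X × Y × (X → X → (X → Bool))) (e : X × Y) : Round X Y where
  x := v.1
  y := v.2.1
  x' := e.1
  y' := e.2
  φ := if e.2 = v.2.1 then none else some (v.2.2 v.1 e.1)

/-- The distribution of the sequence of the first `L` rounds (the most recent round first). -/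
noncomputable def run (A : Algorithm H) (V : Adversary X Y) : ℕ → PMF (List (Round X Y))
  | 0 => PMF.pure []
  | L + 1 => (run A V L).bind fun S =>
      (A.act S (V S).1).map fun e => playRound (V S) e :: S

/-- The number of prediction mistakes in a sequence of rounds. -/
def mistakes (S : List (Round X Y)) : ℕ := S.countP fun r => decide (r.y' ≠ r.y)

/-- The expected number of mistakes of `A` against `V` in `L` rounds. -/
noncomputable def expectedMistakes (A : Algorithm H) (V : Adversary X Y) (L : ℕ) : ℝ≥0∞ :=
  ∑' S, run A V L S * (mistakes S : ℝ≥0∞)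

/-- The feedback of a round is consistent with the teacher `T`. -/
def RoundConsistent (T : Teacher X Y) (r : Round X Y) : Prop :=
  T.label r.x = r.y ∧ (r.y' ≠ r.y → T.feedback r.x r.x' = r.φ)

/-- All rounds of `S`, except for at most `k` of them, are consistent with the teacher `T`. -/
def KConsistent (k : ℕ) (T : Teacher X Y) (S : List (Round X Y)) : Prop :=
  ∃ E : Finset (Fin S.length), E.card ≤ k ∧ ∀ t, t ∉ E → RoundConsistent T (S.get t)

/-- The adversaries that, interacting with `A` for `L` rounds, generate with probability one a
sequence that is `k`-consistent with some teacher of `𝒯`. -/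
def adversaries (k L : ℕ) (A : Algorithm H) (𝒯 : Set (Teacher X Y)) : Set (Adversary X Y) :=
  {V | ∀ S ∈ (run A V L).support, ∃ T ∈ 𝒯, KConsistent k T S}

/-- `M^L_k(A, 𝒯, H)`: the worst-case expected number of mistakes of `A` in `L` rounds of the
`k`-non-realizable setting. -/
noncomputable def mistakeBound (k L : ℕ) (A : Algorithm H) (𝒯 : Set (Teacher X Y)) : ℝ≥0∞ :=
  ⨆ V ∈ adversaries k L A 𝒯, expectedMistakes A V L

/-- A family of algorithms (which may even know the number `L` of rounds and the number `k` of
exceptions) is no-regret if its regret `M^L_k - k` is at most `o(L)`, uniformly in `k`. -/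
def IsNoRegret (A : ℕ → ℕ → Algorithm H) (𝒯 : Set (Teacher X Y)) : Prop :=
  ∀ ε : ℝ, 0 < ε → ∀ᶠ L : ℕ in atTop, ∀ k : ℕ,
    mistakeBound k L (A L k) 𝒯 ≤ ENNReal.ofReal (k + ε * L)

end Run

/-! ## Teacher classes from Shamir's secret sharing

Labels `0` and `1` are `false` and `true`. -/

/-- The history `{(2, 0), (1, 1)}`. -/
def history : Set (ℕ × Bool) := {(2, false), (1, true)}

/-- The block `{2^i, …, 2^(i+1) - 1}` of the domain. -/
def block (i : ℕ) : Finset ℕ := Finset.Ico (2 ^ i) (2 ^ (i + 1))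

/-- The labelings that map `1` to `1` and are `0` outside the `i`-th block and `1`. -/
def labelings (i : ℕ) : Set (ℕ → Bool) :=
  {f | f 1 = true ∧ ∀ x, x ∉ block i → x ≠ 1 → f x = false}

/-- The polynomial `∑ j < m, c j * z ^ j` over the integers modulo `p`; its secret is the value
at `0`. -/
def secretPoly {m p : ℕ} (c : Fin m → ZMod p) (z : ZMod p) : ZMod p := ∑ j, c j * z ^ (j : ℕ)

/-- The share of `x`, shifted to a natural number outside the `i`-th block. -/
def share (i : ℕ) {m p : ℕ} (c : Fin m → ZMod p) (x : ℕ) : ℕ :=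
  2 ^ (i + 1) + (secretPoly c ((x : ZMod p) - 2 ^ i + 1)).val

/-- The teacher with labeling `f` whose feedback on `x, x'` from the `i`-th block is the indicator
of `x` and the share of `x` for the polynomial with coefficients `a x' (f x)`, and whose feedback
is the indicator of `x` otherwise. -/
def shamirTeacher (i : ℕ) {m p : ℕ} (f : ℕ → Bool) (a : ℕ → Bool → Fin m → ZMod p) :
    Teacher ℕ Bool where
  label := f
  feedback x x' := some fun z =>
    if x ∈ block i ∧ x' ∈ block i then decide (z = x ∨ z = share i (a x' (f x)) x)
    else decide (z = x)
  discriminates x x' h := by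
    have hne : x' ≠ x := fun e => h (by rw [e])
    refine ⟨_, rfl, by simp, ?_⟩
    split_ifs with hb
    · have hlt : x' < 2 ^ (i + 1) := (Finset.mem_Ico.mp hb.2).2
      have hs : x' ≠ share i (a x' (f x)) x := by
        unfold share
        omega
      simp [hne, hs]
    · simp [hne]

/-- `𝒯` is the class of all Shamir teachers with threshold `m`, for some choice of primes `p i` with
`p i ≥ 2 ^ (2 ^ i)` and of encodings `b i` of the labelings of the `i`-th block in the field with
`p i` elements.  The polynomials for a true explanation `x'` (with `f x' = 1`) and true label
`0` encode the secret `b i f`; the other polynomials are arbitrary. -/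
def IsShamirClass (m : ℕ) (𝒯 : Set (Teacher ℕ Bool)) : Prop :=
  ∃ (p : ℕ → ℕ) (b : (i : ℕ) → (ℕ → Bool) → ZMod (p i)),
    (∀ i, 1 ≤ i → (p i).Prime ∧ 2 ^ 2 ^ i ≤ p i ∧ Set.InjOn (b i) (labelings i)) ∧
    𝒯 = {T | ∃ i, 1 ≤ i ∧ ∃ f ∈ labelings i, ∃ a : ℕ → Bool → Fin m → ZMod (p i),
      (∀ x' ∈ block i, f x' = true → secretPoly (a x' false) 0 = b i f) ∧
      T = shamirTeacher i f a}

end DFF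

namespace DFF

/-! ## Secret sharing polynomials -/

/-! With threshold `m = d - 1`, a false-positive use of a truly positive explanation reveals one
share of a secret that encodes the whole labeling: `m` shares determine it, while fewer say nothing.

Dimension. In a shattered tree, the edge `(2, false)` forces a positive example `x₁` of some block.
Following the edge of `x₁` then forces label `0` on fresh examples of the block and reveals one
share each time. After `m` shares the labeling is fixed, so no further example can take both labels;
hence height at most `m + 1` (`DFFdim_shamirClass_le`).

Lower bound. The adversary presents fresh examples of a large block with a label that is
mispredicted with probability at least one half, and answers as if all shares were zero. It stops
after `n = (k + 1) * m - 1` mistakes beyond the first round. Since fewer than `(k + 1) * m` shares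
are revealed, at most `k` explanations have received `m` of them. Declaring their rounds exceptions
and labeling them `0` removes the constraint on their polynomials; every other explanation has fewer
than `m` shares, which are compatible with any secret (`exists_kConsistent`). The surplus of half a
mistake in the first round pays for the chance that the target `n` is missed
(`le_expectedMistakes`). Thus each exception costs about `d - 1` mistakes, which gives linear regret
once `d - 1 ≥ 2`. -/

theorem secretPoly_coeff {m p : ℕ} (P : Polynomial (ZMod p)) (hP : P.natDegree < m)
    (z : ZMod p) : secretPoly (fun j : Fin m => P.coeff j) z = P.eval z := by
  rw [Polynomial.eval_eq_sum_range' hP, secretPoly, ← Fin.sum_univ_eq_sum_range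
    (fun j => P.coeff j * z ^ j)]

theorem secretPoly_zero {m p : ℕ} (z : ZMod p) :
    secretPoly (0 : Fin m → ZMod p) z = 0 := by
  simp [secretPoly]

/-- Fewer than `m` shares do not determine the secret. -/
theorem exists_secretPoly_eq {m p : ℕ} [Fact p.Prime] (Z : Finset (ZMod p)) (hZ : Z.card < m)
    (h0 : (0 : ZMod p) ∉ Z) (s : ZMod p) :
    ∃ c : Fin m → ZMod p, secretPoly c 0 = s ∧ ∀ z ∈ Z, secretPoly c z = 0 := by
  classical
  let Q : Polynomial (ZMod p) := ∏ z ∈ Z, (Polynomial.X - Polynomial.C z)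
  have hQ : Q.natDegree = Z.card := by
    simp [Q, Polynomial.natDegree_finsetProd_X_sub_C_eq_card]
  have hQ0 : Q.eval 0 ≠ 0 := by
    simp only [Q, Polynomial.eval_prod]
    refine Finset.prod_ne_zero_iff.mpr fun z hz => ?_
    have : z ≠ 0 := fun h => h0 (h ▸ hz)
    simpa using this
  -- The vanishing polynomial of `Z`, rescaled to take the value `s` at `0`.
  let P : Polynomial (ZMod p) := Polynomial.C (s / Q.eval 0) * Q
  have hP : P.natDegree < m := by
    have := Polynomial.natDegree_C_mul_le (s / Q.eval 0) Q
    simp only [P]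
    omega
  refine ⟨fun j => P.coeff j, ?_, fun z hz => ?_⟩
  · rw [secretPoly_coeff P hP]
    simp [P, hQ0]
  · rw [secretPoly_coeff P hP]
    simp only [P, Q, Polynomial.eval_mul, Polynomial.eval_prod]
    exact mul_eq_zero_of_right _ (Finset.prod_eq_zero hz (by simp))

/-- `m` shares determine the secret. -/
theorem secretPoly_eq_of_eq_on {m p : ℕ} [Fact p.Prime] (Z : Finset (ZMod p)) (hZ : m ≤ Z.card)
    (c c' : Fin m → ZMod p) (h : ∀ z ∈ Z, secretPoly c z = secretPoly c' z) (w : ZMod p) :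
    secretPoly c w = secretPoly c' w := by
  classical
  let P : (Fin m → ZMod p) → Polynomial (ZMod p) := fun c =>
    ∑ j : Fin m, Polynomial.C (c j) * Polynomial.X ^ (j : ℕ)
  have hdeg : ∀ c, (P c).degree < Z.card := fun c => by
    refine lt_of_lt_of_le (Polynomial.degree_sum_fin_lt c) ?_
    exact_mod_cast hZ
  have heval : ∀ c z, (P c).eval z = secretPoly c z := fun c z => by
    simp [P, secretPoly, Polynomial.eval_finsetSum]
  have := Polynomial.eq_of_degrees_lt_of_eval_finset_eq Z (hdeg c) (hdeg c')
    (fun z hz => by rw [heval, heval, h z hz])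
  rw [← heval, ← heval, this]

/-! ## Shares of the examples of a block -/

theorem block_index_unique {i j x : ℕ} (hi : x ∈ block i) (hj : x ∈ block j) : i = j := by
  simp only [block, Finset.mem_Ico] at hi hj
  by_contra hne
  rcases Nat.lt_or_gt_of_ne hne with h | h
  · have := Nat.pow_le_pow_right (show 0 < 2 by norm_num) (show i + 1 ≤ j by omega)
    omega
  · have := Nat.pow_le_pow_right (show 0 < 2 by norm_num) (show j + 1 ≤ i by omega)
    omega

/-- The node at which the polynomial is evaluated for the share of `x`. -/
def shareNode (i p x : ℕ) : ZMod p := (x : ZMod p) - 2 ^ i + 1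

theorem shareNode_eq_cast {i p x : ℕ} (hx : x ∈ block i) :
    shareNode i p x = ((x - 2 ^ i + 1 : ℕ) : ZMod p) := by
  simp only [block, Finset.mem_Ico] at hx
  simp [shareNode, Nat.cast_sub hx.1]

theorem two_pow_lt_of_two_pow_two_pow_le {i p : ℕ} (hp : 2 ^ 2 ^ i ≤ p) : 2 ^ i < p :=
  lt_of_lt_of_le Nat.lt_two_pow_self hp

/-- The nodes of the block are the residues of `1, …, 2 ^ i`, and `2 ^ i < p`. A node at `0` would
disclose the secret itself. -/
theorem shareNode_ne_zero {i p x : ℕ} (hp : 2 ^ 2 ^ i ≤ p) (hx : x ∈ block i) :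
    shareNode i p x ≠ 0 := by
  rw [shareNode_eq_cast hx, Ne, ZMod.natCast_eq_zero_iff]
  have h := two_pow_lt_of_two_pow_two_pow_le hp
  simp only [block, Finset.mem_Ico, pow_succ] at hx
  intro hd
  have := Nat.le_of_dvd (by omega) hd
  omega

theorem shareNode_injOn {i p : ℕ} (hp : 2 ^ 2 ^ i ≤ p) :
    Set.InjOn (shareNode i p) (block i) := by
  intro x hx y hy h
  have h' := two_pow_lt_of_two_pow_two_pow_le hp
  rw [shareNode_eq_cast hx, shareNode_eq_cast hy, ZMod.natCast_eq_natCast_iff'] at h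
  simp only [block, Finset.coe_Ico, Set.mem_Ico, pow_succ] at hx hy
  rw [Nat.mod_eq_of_lt (by omega), Nat.mod_eq_of_lt (by omega)] at h
  omega

/-- The feedback of a Shamir teacher inside the block reveals the share. -/
theorem secretPoly_eq_of_feedback_eq {i m p x x' : ℕ} [NeZero p] {f f' : ℕ → Bool}
    {a a' : ℕ → Bool → Fin m → ZMod p} (hx : x ∈ block i) (hx' : x' ∈ block i)
    (h : (shamirTeacher i f a).feedback x x' = (shamirTeacher i f' a').feedback x x') :
    secretPoly (a x' (f x)) (shareNode i p x) = secretPoly (a' x' (f' x)) (shareNode i p x) := by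
  -- The first feature holds at its own share, which lies beyond the block and so differs from `x`;
  -- for the second feature to hold there, the shares must coincide.
  have h1 := congrFun (Option.some.inj h) (share i (a x' (f x)) x)
  have hne : share i (a x' (f x)) x ≠ x := by
    have := (Finset.mem_Ico.mp hx).2
    unfold share
    omega
  simp only [hx, hx', and_self, if_true, hne, false_or, decide_true] at h1
  have h2 := of_decide_eq_true h1.symm
  exact ZMod.val_injective p (Nat.add_left_cancel h2)

/-! ## Shamir classes -/

/-- The Shamir class with threshold `m` for the primes `p` and the encodings `b`. -/
def shamirClass (m : ℕ) (p : ℕ → ℕ) (b : (i : ℕ) → (ℕ → Bool) → ZMod (p i)) :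
    Set (Teacher ℕ Bool) :=
  {T | ∃ i, 1 ≤ i ∧ ∃ f ∈ labelings i, ∃ a : ℕ → Bool → Fin m → ZMod (p i),
      (∀ x' ∈ block i, f x' = true → secretPoly (a x' false) 0 = b i f) ∧
      T = shamirTeacher i f a}

/-- The requirements on the primes and the encodings of a Shamir class. -/
def IsEncoding (p : ℕ → ℕ) (b : (i : ℕ) → (ℕ → Bool) → ZMod (p i)) : Prop :=
  ∀ i, 1 ≤ i → (p i).Prime ∧ 2 ^ 2 ^ i ≤ p i ∧ Set.InjOn (b i) (labelings i)

/-- A labeling is determined by its restriction to the `2 ^ i` points of the block. -/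
theorem exists_injOn_labelings (i q : ℕ) [NeZero q] (hq : 2 ^ 2 ^ i ≤ q) :
    ∃ b : (ℕ → Bool) → ZMod q, Set.InjOn b (labelings i) := by
  have hcard : Fintype.card (block i → Bool) ≤ Fintype.card (ZMod q) := by
    have : 2 ^ (i + 1) - 2 ^ i = 2 ^ i := by rw [pow_succ]; omega
    rw [Fintype.card_fun, Fintype.card_coe, block, Nat.card_Ico, this, ZMod.card, Fintype.card_bool]
    exact hq
  obtain ⟨e⟩ := Function.Embedding.nonempty_of_card_le hcard
  refine ⟨fun f => e fun x => f x, fun f hf g hg h => ?_⟩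
  funext x
  by_cases hx : x ∈ block i
  · exact congrFun (e.injective h) ⟨x, hx⟩
  · by_cases h1 : x = 1
    · rw [h1, hf.1, hg.1]
    · rw [hf.2 x hx h1, hg.2 x hx h1]

theorem exists_isEncoding : ∃ p b, IsEncoding p b := by
  choose p hp using fun i => Nat.exists_infinite_primes (2 ^ 2 ^ i)
  have := fun i => NeZero.mk (hp i).2.ne_zero
  choose b hb using fun i => exists_injOn_labelings i (p i) (hp i).1
  exact ⟨p, b, fun i _ => ⟨(hp i).2, (hp i).1, hb i⟩⟩

theorem consistentTeachers_shamirClass_nonempty {m : ℕ} {p : ℕ → ℕ}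
    {b : (i : ℕ) → (ℕ → Bool) → ZMod (p i)} :
    (consistentTeachers (shamirClass m p b) history).Nonempty := by
  -- This labeling has no positive example in the block, so the condition on the secret is vacuous.
  let f : ℕ → Bool := fun x => decide (x = 1)
  refine ⟨shamirTeacher 1 f (fun _ _ (_ : Fin m) => (0 : ZMod (p 1))),
    ⟨1, le_rfl, f, ⟨by simp [f], fun x _ h => by simp [f, h]⟩, _, ?_, rfl⟩, ?_⟩
  · intro x' hx' h
    simp only [f, decide_eq_true_eq] at h
    simp [block, h] at hx'
  · rintro e (rfl | rfl) <;> simp [shamirTeacher, f]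

/-! ## Descending in shattered trees -/

namespace Tree

variable {X Y : Type*}

theorem Path.append {t u v : Tree X Y} {p q : List (Step X Y)} (h : Path t p u)
    (h' : Path u q v) : Path t (p ++ q) v := by
  induction h with
  | nil t => exact h'
  | cons y φ x E child e p v _ ih => exact .cons y φ x E child e _ _ (ih h')

theorem exists_path_isLeaf (t : Tree X Y) : ∃ p v, Path t p v ∧ v.IsLeaf := by
  induction t with
  | node y φ x E child ih =>
    by_cases hE : E = ∅
    · exact ⟨[], _, .nil _, hE⟩
    · obtain ⟨e, he⟩ := Set.nonempty_iff_ne_empty.mpr hE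
      obtain ⟨p, v, h, hv⟩ := ih ⟨e, he⟩
      exact ⟨_, v, .cons y φ x E child ⟨e, he⟩ p v h, hv⟩

theorem exists_path_single {t : Tree X Y} {e : X × Y} (he : e ∈ t.rootEdges) :
    ∃ s v, Path t [s] v ∧ s.edge = e ∧ s.x = t.rootExample := by
  cases t with
  | node y φ x E child => exact ⟨_, _, .cons y φ x E child ⟨e, he⟩ [] _ (.nil _), rfl, rfl⟩

variable {𝒯 : Set (Teacher X Y)} {H : Set (X × Y)} {n : ℕ} {t : Tree X Y}

/-- Shattering supplies teachers for paths to leaves only; every path extends to such a path, and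
consistency passes to prefixes. -/
theorem IsShattered.exists_teacher (ht : t.IsShattered 𝒯 H n) {p : List (Step X Y)}
    {v : Tree X Y} (h : Path t p v) : ∃ T ∈ consistentTeachers 𝒯 H, PathConsistent T p := by
  obtain ⟨q, w, hq, hw⟩ := v.exists_path_isLeaf
  obtain ⟨T, hT, hc⟩ := ht.consistent _ _ (h.append hq) hw
  exact ⟨T, hT, fun s hs => hc s (List.mem_append_left _ hs)⟩

/-- Below an inner node of a shattered tree with example `x`, one may follow any edge, and
arrives at the other label. -/
theorem IsShattered.exists_step (ht : t.IsShattered 𝒯 H n) {p : List (Step X Y)}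
    {v : Tree X Y} (h : Path t p v) (hp : p.length < n) :
    ∃ x : X, ∀ e ∈ H ∪ labeledExamples p, ∃ (y : Y) (φ : Option (X → Bool)) (w : Tree X Y),
      Path t (p ++ [⟨some x, e, some y, φ⟩]) w ∧ y ≠ e.2 := by
  have hv : ¬ v.IsLeaf := fun hv => hp.ne (ht.complete p v h hv)
  obtain ⟨x, hx⟩ := Option.ne_none_iff_exists'.mp (fun h' => hv ((ht.isDFFT.leaf_iff p v h).mp h'))
  refine ⟨x, fun e he => ?_⟩
  rw [← ht.edges_eq p v h hv] at he
  obtain ⟨s, w, hs, rfl, hsx⟩ := exists_path_single he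
  have hw := h.append hs
  have hmem : s ∈ p ++ [s] := by simp
  have hne := ht.label_ne _ _ hw s hmem
  obtain ⟨T, -, hT⟩ := ht.exists_teacher hw
  obtain ⟨x', -, hy, -⟩ := hT s hmem
  refine ⟨T.label x', s.φ, w, ?_, ?_⟩
  · rw [← hx, ← hsx, ← hy]
    exact hw
  · rintro h'
    exact hne (by rw [hy, h'])

end Tree

open DFF.Tree

theorem PathConsistent.label_eq {X Y : Type*} {T : Teacher X Y} {p : List (Step X Y)}
    (h : PathConsistent T p) {x : X} {e : X × Y} {y : Y} {φ : Option (X → Bool)}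
    (hs : ⟨some x, e, some y, φ⟩ ∈ p) : T.label x = y := by
  obtain ⟨x', hx, hy, -⟩ := h _ hs
  obtain rfl := Option.some.inj hx
  exact (Option.some.inj hy).symm

theorem PathConsistent.feedback_eq {X Y : Type*} {T : Teacher X Y} {p : List (Step X Y)}
    (h : PathConsistent T p) {x : X} {e : X × Y} {y : Y} {φ : Option (X → Bool)}
    (hs : ⟨some x, e, some y, φ⟩ ∈ p) (hne : y ≠ e.2) : T.feedback x e.1 = φ := by
  obtain ⟨x', hx, hy, hφ⟩ := h _ hs
  obtain rfl := Option.some.inj hx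
  exact hφ fun h' => hne (Option.some.inj h')

/-! ### The upper bound on the DFF dimension -/

section Dimension

variable {m : ℕ} {p : ℕ → ℕ} {b : (i : ℕ) → (ℕ → Bool) → ZMod (p i)} {n : ℕ} {t : Tree ℕ Bool}

/-- The first edge of a shattered tree for a Shamir class may reveal an example with label `1` from
a block. -/
theorem IsShattered.exists_first_step (ht : t.IsShattered (shamirClass m p b) history n)
    (hn : 0 < n) : ∃ (x₁ i : ℕ) (φ : Option (ℕ → Bool)) (v : Tree ℕ Bool),
      x₁ ∈ block i ∧ x₁ ≠ 1 ∧ Path t [⟨some x₁, (2, false), some true, φ⟩] v := by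
  obtain ⟨x, hx⟩ := ht.exists_step (Path.nil t) hn
  -- At the example `1`, the edge `(1, true)` would demand the label `0`, against the history.
  have hx1 : x ≠ 1 := by
    rintro rfl
    obtain ⟨y, φ, w, hw, hy⟩ := hx (1, true) (by simp [history])
    obtain ⟨T, ⟨-, hT⟩, hc⟩ := ht.exists_teacher hw
    have h1 := PathConsistent.label_eq hc (List.mem_singleton_self _)
    have h2 : T.label 1 = true := hT (1, true) (by simp [history])
    exact hy (by rw [← h1, h2])
  obtain ⟨y, φ, w, hw, hy⟩ := hx (2, false) (by simp [history])
  obtain rfl : y = true := by simpa using hy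
  obtain ⟨T, ⟨⟨i, -, f, hf, a, -, rfl⟩, -⟩, hc⟩ := ht.exists_teacher hw
  have h1 : f x = true := PathConsistent.label_eq hc (T := shamirTeacher i f a)
    (List.mem_singleton_self _)
  refine ⟨x, i, φ, w, ?_, hx1, by simpa using hw⟩
  by_contra hxi
  rw [hf.2 x hxi hx1] at h1
  cases h1

/-- A path to a positive example `x₁` of a block may be extended such that it reveals `j` shares
for the explanation `x₁`. -/
theorem IsShattered.exists_path_shares (ht : t.IsShattered (shamirClass m p b) history n)
    {x₁ i : ℕ} {φ : Option (ℕ → Bool)} {v : Tree ℕ Bool} (hx₁ : x₁ ∈ block i) (h1 : x₁ ≠ 1)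
    (hv : Path t [⟨some x₁, (2, false), some true, φ⟩] v) (j : ℕ) (hj : j < n) :
    ∃ (q : List (Step ℕ Bool)) (w : Tree ℕ Bool) (F : Finset ℕ), Path t q w ∧ q.length = j + 1 ∧
      F.card = j ∧ F ⊆ block i ∧ ⟨some x₁, (2, false), some true, φ⟩ ∈ q ∧
      ∀ x ∈ F, ∃ φ', ⟨some x, (x₁, true), some false, φ'⟩ ∈ q := by
  induction j with
  | zero => exact ⟨_, v, ∅, hv, rfl, rfl, by simp, by simp, by simp⟩
  | succ j ih =>
    obtain ⟨q, w, F, hq, hlen, hcard, hF, hmem, hsh⟩ := ih (by omega)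
    obtain ⟨x, hx⟩ := ht.exists_step hq (by omega)
    -- The edge `(2, false)` forces `x` to be positive for a teacher that also has `x₁` positive.
    -- That teacher belongs to block `i`, so outside the block only `x = 1` remains, which the edge
    -- `(1, true)` excludes.
    have hxi : x ∈ block i := by
      by_contra hxi
      obtain ⟨y, φ', w', hw', hy⟩ := hx (2, false) (by simp [history])
      obtain rfl : y = true := by simpa using hy
      obtain ⟨T, ⟨⟨i', -, f, hf, a, -, rfl⟩, -⟩, hc⟩ := ht.exists_teacher hw'
      have hl : f x = true := PathConsistent.label_eq hc (T := shamirTeacher i' f a)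
        (List.mem_append_right _ (List.mem_singleton_self _))
      have hl₁ : f x₁ = true := PathConsistent.label_eq hc (T := shamirTeacher i' f a)
        (List.mem_append_left _ hmem)
      have hi' : x₁ ∈ block i' := by
        by_contra h
        rw [hf.2 x₁ h h1] at hl₁
        cases hl₁
      obtain rfl := block_index_unique hx₁ hi'
      have hx1 : x = 1 := by
        by_contra h
        rw [hf.2 x hxi h] at hl
        cases hl
      subst hx1
      obtain ⟨y, φ', w', hw', hy⟩ := hx (1, true) (by simp [history])
      obtain ⟨T, ⟨-, hT⟩, hc⟩ := ht.exists_teacher hw'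
      have h1 := PathConsistent.label_eq hc (List.mem_append_right _ (List.mem_singleton_self _))
      have h2 : T.label 1 = true := hT (1, true) (by simp [history])
      exact hy (by rw [← h1, h2])
    -- A repeated example would meet its own edge `(x, false)`, which demands the opposite label.
    have hxF : x ∉ F := by
      intro hxF
      obtain ⟨φ', hφ'⟩ := hsh x hxF
      obtain ⟨y, φ'', w', hw', hy⟩ := hx (x, false) (Or.inr ⟨_, hφ', rfl, rfl⟩)
      obtain ⟨T, -, hc⟩ := ht.exists_teacher hw'
      have h1 := PathConsistent.label_eq hc (List.mem_append_right _ (List.mem_singleton_self _))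
      have h2 := PathConsistent.label_eq hc (List.mem_append_left _ hφ')
      exact hy (by rw [← h1, h2])
    obtain ⟨y, φ', w', hw', hy⟩ := hx (x₁, true) (Or.inr ⟨_, hmem, rfl, rfl⟩)
    obtain rfl : y = false := by simpa using hy
    refine ⟨_, w', insert x F, hw', by simp [hlen], by simp [hxF, hcard],
      Finset.insert_subset hxi hF, List.mem_append_left _ hmem, fun z hz => ?_⟩
    rcases Finset.mem_insert.mp hz with rfl | hz
    · exact ⟨φ', by simp⟩
    · obtain ⟨φ'', h''⟩ := hsh z hz
      exact ⟨φ'', List.mem_append_left _ h''⟩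

theorem DFFdim_shamirClass_le (hb : IsEncoding p b) :
    DFFdim (shamirClass m p b) history ≤ (m + 1 : ℕ) := by
  classical
  refine iSup₂_le fun n ⟨t, ht⟩ => ?_
  by_contra! hn
  replace hn : m + 1 < n := by exact_mod_cast hn
  obtain ⟨x₁, i, φ, v, hx₁, h1, hv⟩ := IsShattered.exists_first_step ht (by omega)
  obtain ⟨q, w, F, hq, hlen, hcard, hF, hmem, hsh⟩ :=
    IsShattered.exists_path_shares ht hx₁ h1 hv m (by omega)
  obtain ⟨x, hx⟩ := ht.exists_step hq (by omega)
  -- The two children give teachers that agree on all `m` shares along the common path but disagree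
  -- on the label of `x`.
  obtain ⟨y, φ₁, w₁, hw₁, hy⟩ := hx (2, false) (by simp [history])
  obtain rfl : y = true := by simpa using hy
  obtain ⟨y, φ₂, w₂, hw₂, hy⟩ := hx (1, true) (by simp [history])
  obtain rfl : y = false := by simpa using hy
  obtain ⟨T, ⟨⟨i', hi1, f, hf, a, ha, rfl⟩, -⟩, hc⟩ := ht.exists_teacher hw₁
  obtain ⟨T, ⟨⟨i'', -, g, hg, a', ha', rfl⟩, -⟩, hc'⟩ := ht.exists_teacher hw₂
  have hfx : f x = true := PathConsistent.label_eq hc (T := shamirTeacher i' f a)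
    (List.mem_append_right _ (List.mem_singleton_self _))
  have hgx : g x = false := PathConsistent.label_eq hc' (T := shamirTeacher i'' g a')
    (List.mem_append_right _ (List.mem_singleton_self _))
  have hf₁ : f x₁ = true := PathConsistent.label_eq hc (T := shamirTeacher i' f a)
    (List.mem_append_left _ hmem)
  have hg₁ : g x₁ = true := PathConsistent.label_eq hc' (T := shamirTeacher i'' g a')
    (List.mem_append_left _ hmem)
  have hi' : x₁ ∈ block i' := by
    by_contra h
    rw [hf.2 x₁ h h1] at hf₁
    cases hf₁
  have hi'' : x₁ ∈ block i'' := by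
    by_contra h
    rw [hg.2 x₁ h h1] at hg₁
    cases hg₁
  obtain rfl := block_index_unique hx₁ hi'
  obtain rfl := block_index_unique hx₁ hi''
  obtain ⟨hprime, hbig, hinj⟩ := hb i hi1
  have : Fact (p i).Prime := ⟨hprime⟩
  have hsec : secretPoly (a x₁ false) 0 = secretPoly (a' x₁ false) 0 := by
    refine secretPoly_eq_of_eq_on (F.image (shareNode i (p i))) ?_ _ _ ?_ 0
    · rw [Finset.card_image_of_injOn ((shareNode_injOn hbig).mono (by exact_mod_cast hF)), hcard]
    · intro z hz
      obtain ⟨x₂, hx₂, rfl⟩ := Finset.mem_image.mp hz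
      obtain ⟨φ', hφ'⟩ := hsh x₂ hx₂
      have hf₂ : f x₂ = false := PathConsistent.label_eq hc (T := shamirTeacher i f a)
        (List.mem_append_left _ hφ')
      have hg₂ : g x₂ = false := PathConsistent.label_eq hc' (T := shamirTeacher i g a')
        (List.mem_append_left _ hφ')
      have e₁ := PathConsistent.feedback_eq hc (List.mem_append_left _ hφ') (by simp)
      have e₂ := PathConsistent.feedback_eq hc' (List.mem_append_left _ hφ') (by simp)
      have := secretPoly_eq_of_feedback_eq (hF hx₂) hx₁ (e₁.trans e₂.symm)
      rwa [hf₂, hg₂] at this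
  rw [ha x₁ hx₁ hf₁, ha' x₁ hx₁ hg₁] at hsec
  rw [hinj hf hg hsec, hgx] at hfx
  cases hfx

end Dimension

/-! ## Expectations of discrete random variables -/

section Expectation

variable {α β : Type*}

/-- The expectation of a function with respect to a discrete distribution. -/
noncomputable def expect (P : PMF α) (F : α → ℝ≥0∞) : ℝ≥0∞ := ∑' a, P a * F a

theorem expect_pure (a : α) (F : α → ℝ≥0∞) : expect (PMF.pure a) F = F a := by
  classical
  rw [expect, tsum_eq_single a fun b hb => by simp [PMF.pure_apply, hb]]
  simp

theorem expect_bind (P : PMF α) (f : α → PMF β) (F : β → ℝ≥0∞) :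
    expect (P.bind f) F = expect P fun a => expect (f a) F := by
  simp only [expect, PMF.bind_apply, ← ENNReal.tsum_mul_right, ← ENNReal.tsum_mul_left]
  rw [ENNReal.tsum_comm]
  simp only [mul_assoc]

theorem expect_map (P : PMF α) (g : α → β) (F : β → ℝ≥0∞) :
    expect (P.map g) F = expect P fun a => F (g a) := by
  simp only [PMF.map, expect_bind, Function.comp, expect_pure]

theorem expect_mono {P : PMF α} {F G : α → ℝ≥0∞} (h : ∀ a ∈ P.support, F a ≤ G a) :
    expect P F ≤ expect P G := by
  refine ENNReal.tsum_le_tsum fun a => ?_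
  by_cases ha : a ∈ P.support
  · gcongr
    exact h a ha
  · rw [PMF.mem_support_iff, not_not] at ha
    simp [ha]

theorem expect_add (P : PMF α) (F G : α → ℝ≥0∞) :
    expect P (fun a => F a + G a) = expect P F + expect P G := by
  simp only [expect, mul_add, ENNReal.tsum_add]

theorem expect_const (P : PMF α) (c : ℝ≥0∞) : expect P (fun _ => c) = c := by
  rw [expect, ENNReal.tsum_mul_right, PMF.tsum_coe, one_mul]

theorem expect_const_mul (P : PMF α) (c : ℝ≥0∞) (F : α → ℝ≥0∞) :
    expect P (fun a => c * F a) = c * expect P F := by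
  rw [expect, expect, ← ENNReal.tsum_mul_left]
  exact tsum_congr fun a => by ring

theorem expect_run_succ {X Y : Type*} [DecidableEq Y] {H : Set (X × Y)} (A : Algorithm H)
    (V : Adversary X Y) (L : ℕ) (F : List (Round X Y) → ℝ≥0∞) :
    expect (run A V (L + 1)) F = expect (run A V L) fun S =>
      expect (A.act S (V S).1) fun e => F (playRound (V S) e :: S) := by
  rw [run, expect_bind]
  simp only [expect_map]

theorem mem_support_run_succ {X Y : Type*} [DecidableEq Y] {H : Set (X × Y)} {A : Algorithm H}
    {V : Adversary X Y} {L : ℕ} {S : List (Round X Y)} (h : S ∈ (run A V (L + 1)).support) :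
    ∃ S' ∈ (run A V L).support, ∃ e ∈ (A.act S' (V S').1).support,
      S = playRound (V S') e :: S' := by
  rw [run, PMF.mem_support_bind_iff] at h
  obtain ⟨S', hS', h⟩ := h
  rw [PMF.mem_support_map_iff] at h
  obtain ⟨e, he, rfl⟩ := h
  exact ⟨S', hS', e, he, rfl⟩

theorem length_of_mem_support_run {X Y : Type*} [DecidableEq Y] {H : Set (X × Y)}
    {A : Algorithm H} {V : Adversary X Y} {L : ℕ} {S : List (Round X Y)}
    (h : S ∈ (run A V L).support) : S.length = L := by
  induction L generalizing S with
  | zero =>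
    rw [run, PMF.mem_support_pure_iff] at h
    simp [h]
  | succ L ih =>
    obtain ⟨S', hS', e, -, rfl⟩ := mem_support_run_succ h
    simp [ih hS']

end Expectation

/-- The probability that a random prediction differs from the label `y`. -/
noncomputable def missProb (P : PMF (ℕ × Bool)) (y : Bool) : ℝ≥0∞ :=
  expect P fun e => if e.2 = y then 0 else 1

open scoped Classical in
/-- A label that is mispredicted with probability at least one half. -/
noncomputable def hardLabel (P : PMF (ℕ × Bool)) : Bool := decide (1 ≤ 2 * missProb P true)

/-- Every prediction is wrong for exactly one of the two labels, so the two miss probabilities sum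
to one. -/
theorem one_le_two_mul_missProb_hardLabel (P : PMF (ℕ × Bool)) :
    1 ≤ 2 * missProb P (hardLabel P) := by
  classical
  by_cases h : 1 ≤ 2 * missProb P true
  · have : hardLabel P = true := decide_eq_true h
    rwa [this]
  · have : hardLabel P = false := decide_eq_false h
    rw [this]
    have hsum : missProb P true + missProb P false = 1 := by
      rw [missProb, missProb, ← expect_add]
      refine Eq.trans (congrArg (expect P) (funext fun e => ?_)) (expect_const P 1)
      cases e.2 <;> simp
    by_contra! h'
    push Not at h
    have := ENNReal.add_lt_add h h'
    rw [← mul_add, hsum] at this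
    norm_num at this

/-! ## The adversary -/

/-- The feedback of a Shamir teacher for the zero polynomials. -/
def zeroFeedback (i x x' z : ℕ) : Bool :=
  if x ∈ block i ∧ x' ∈ block i then decide (z = x ∨ z = 2 ^ (i + 1)) else decide (z = x)

/-- Until `n` mistakes have been made after the first round, the adversary selects a fresh example
of the `i`-th block with a label that is hard to predict. -/
noncomputable def blockAdversary (i n : ℕ) (A : Algorithm history) : Adversary ℕ Bool := fun S =>
  -- The most recent round comes first, so `dropLast` discards the very first round. Its mistake is
  -- free: the explanation comes from the history and reveals no share when `2 ≤ i`.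
  if mistakes S.dropLast < n then
    (2 ^ i + S.length, hardLabel (A.act S (2 ^ i + S.length)), zeroFeedback i)
  else (1, true, zeroFeedback i)

theorem mistakes_cons (v : ℕ × Bool × (ℕ → ℕ → ℕ → Bool)) (e : ℕ × Bool)
    (S : List (Round ℕ Bool)) :
    mistakes (playRound v e :: S) = mistakes S + if e.2 = v.2.1 then 0 else 1 := by
  by_cases h : e.2 = v.2.1 <;> simp [mistakes, playRound, h]

theorem dropLast_cons {α : Type*} (a : α) {S : List α} (hS : S ≠ []) :
    (a :: S).dropLast = a :: S.dropLast := by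
  cases S with
  | nil => exact absurd rfl hS
  | cons b S => rfl

/-! ### The expected number of mistakes -/

section Mistakes

variable {i n : ℕ} {A : Algorithm history}

theorem blockAdversary_of_lt {S : List (Round ℕ Bool)} (h : mistakes S.dropLast < n) :
    blockAdversary i n A S =
      (2 ^ i + S.length, hardLabel (A.act S (2 ^ i + S.length)), zeroFeedback i) :=
  if_pos h

theorem blockAdversary_of_not_lt {S : List (Round ℕ Bool)} (h : ¬ mistakes S.dropLast < n) :
    blockAdversary i n A S = (1, true, zeroFeedback i) :=
  if_neg h

theorem one_le_two_mul_expect_miss {S : List (Round ℕ Bool)} (h : mistakes S.dropLast < n) :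
    1 ≤ 2 * expect (A.act S (blockAdversary i n A S).1)
      fun e => if e.2 = (blockAdversary i n A S).2.1 then 0 else 1 := by
  rw [blockAdversary_of_lt h]
  exact one_le_two_mul_missProb_hardLabel _

/-- A weight that is exponential in the number of mistakes that the adversary still aims at. -/
noncomputable def pendingWeight (n : ℕ) (S : List (Round ℕ Bool)) : ℝ≥0∞ :=
  -- The value is `0` rather than `2 ^ 0` once the target is reached, since the weight could not
  -- decay further from there.
  if mistakes S.dropLast < n then 2 ^ (n - mistakes S.dropLast) else 0

/-- A mistake, which has probability at least one half, at least halves the weight; hence the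
expected weight shrinks by the factor `3 / 4`. -/
theorem expect_pendingWeight_cons_le {S : List (Round ℕ Bool)} (hS : S ≠ []) :
    4 * (expect (A.act S (blockAdversary i n A S).1) fun e =>
      pendingWeight n (playRound (blockAdversary i n A S) e :: S)) ≤ 3 * pendingWeight n S := by
  set V := blockAdversary i n A S with hV
  by_cases h : mistakes S.dropLast < n
  · have hq := one_le_two_mul_expect_miss (i := i) (A := A) h
    rw [← hV] at hq
    set q := expect (A.act S V.1) fun e => if e.2 = V.2.1 then 0 else 1 with hqdef
    obtain ⟨j, hj⟩ : ∃ j, n - mistakes S.dropLast = j + 1 := ⟨n - mistakes S.dropLast - 1, by omega⟩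
    set u : ℝ≥0∞ := 2 ^ j with hu
    have hutop : 2 * u ≠ ⊤ := by simp [hu, ENNReal.mul_eq_top]
    have hpt : (expect (A.act S V.1) fun e => pendingWeight n (playRound V e :: S)) + u * q
        ≤ 2 * u := by
      rw [hqdef, ← expect_const_mul, ← expect_add, ← expect_const (A.act S V.1) (2 * u)]
      refine expect_mono fun e _ => ?_
      rw [pendingWeight, dropLast_cons _ hS, mistakes_cons]
      by_cases he : e.2 = V.2.1
      · rw [if_pos he, if_pos he, add_zero, if_pos h, hj, pow_succ, mul_zero, add_zero, mul_comm]
      · rw [if_neg he, if_neg he, mul_one, two_mul]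
        gcongr
        split_ifs
        · rw [show n - (mistakes S.dropLast + 1) = j by omega]
        · exact zero_le
    rw [pendingWeight, if_pos h, hj, pow_succ, ← hu]
    set w := expect (A.act S V.1) fun e => pendingWeight n (playRound V e :: S)
    refine (ENNReal.add_le_add_iff_right hutop).mp ?_
    calc 4 * w + 2 * u = 4 * w + 2 * u * 1 := by ring
      _ ≤ 4 * w + 2 * u * (2 * q) := by gcongr
      _ = 4 * (w + u * q) := by ring
      _ ≤ 4 * (2 * u) := by gcongr
      _ = 3 * (u * 2) + 2 * u := by ring
  · have hz : ∀ e, pendingWeight n (playRound V e :: S) = 0 := fun e => by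
      rw [pendingWeight, dropLast_cons _ hS, mistakes_cons, if_neg (by omega)]
    simp only [hz]
    rw [expect_const, mul_zero]
    exact zero_le

theorem expect_pendingWeight_le (t : ℕ) :
    4 ^ t * expect (run A (blockAdversary i n A) (t + 1)) (pendingWeight n) ≤ 3 ^ t * 2 ^ n := by
  induction t with
  | zero =>
    rw [pow_zero, pow_zero, one_mul, one_mul, ← expect_const (run A (blockAdversary i n A) (0 + 1))
      (2 ^ n)]
    refine expect_mono fun S _ => ?_
    rw [pendingWeight]
    split_ifs
    · exact pow_le_pow_right₀ (by norm_num) (Nat.sub_le _ _)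
    · exact zero_le
  | succ t ih =>
    rw [expect_run_succ, pow_succ, mul_assoc, ← expect_const_mul]
    calc _ ≤ 4 ^ t * expect (run A (blockAdversary i n A) (t + 1))
          (fun S => 3 * pendingWeight n S) := by
          gcongr
          refine expect_mono fun S hS => expect_pendingWeight_cons_le ?_
          rintro rfl
          simpa using length_of_mem_support_run hS
      _ = 3 * (4 ^ t * expect (run A (blockAdversary i n A) (t + 1)) (pendingWeight n)) := by
          rw [expect_const_mul]
          ring
      _ ≤ 3 * (3 ^ t * 2 ^ n) := by gcongr
      _ = 3 ^ (t + 1) * 2 ^ n := by ring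

/-- Mistakes plus those still pending never decrease: a later mistake raises the first term by one
and lowers the truncated difference by at most one. After the first round the expectation is `n`
plus the probability of a mistake in it. -/
theorem two_mul_add_one_le_expect (hn : 0 < n) (t : ℕ) :
    2 * (n : ℝ≥0∞) + 1 ≤ 2 * expect (run A (blockAdversary i n A) (t + 1))
      fun S => ((mistakes S + (n - mistakes S.dropLast) : ℕ) : ℝ≥0∞) := by
  induction t with
  | zero =>
    rw [expect_run_succ, run, expect_pure]
    have hq := one_le_two_mul_expect_miss (i := i) (n := n) (A := A) (S := []) hn
    set V := blockAdversary i n A []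
    have hG : ∀ e : ℕ × Bool, ((mistakes (playRound V e :: []) +
        (n - mistakes (List.dropLast (playRound V e :: []))) : ℕ) : ℝ≥0∞) =
        n + if e.2 = V.2.1 then 0 else 1 := fun e => by
      rw [mistakes_cons]
      by_cases he : e.2 = V.2.1 <;> simp [he, mistakes, add_comm]
    simp only [hG]
    rw [expect_add, expect_const, mul_add]
    gcongr
  | succ t ih =>
    refine ih.trans ?_
    rw [expect_run_succ _ _ (t + 1)]
    gcongr
    refine expect_mono fun S hS => ?_
    have hne : S ≠ [] := by
      rintro rfl
      simpa using length_of_mem_support_run hS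
    conv_lhs => rw [← expect_const (A.act S (blockAdversary i n A S).1)
      ((mistakes S + (n - mistakes S.dropLast) : ℕ) : ℝ≥0∞)]
    refine expect_mono fun e _ => ?_
    rw [dropLast_cons _ hne, mistakes_cons, mistakes_cons, Nat.cast_le]
    omega

/-- The expected number of pending mistakes is at most one half, because twice that number is
dominated by `pendingWeight`; the half mistake from the first round makes up for it. -/
theorem le_expectedMistakes (hn : 0 < n) {L : ℕ} (hL : 4 * n < L) :
    (n : ℝ≥0∞) ≤ expectedMistakes A (blockAdversary i n A) L := by
  obtain ⟨t, rfl⟩ : ∃ t, L = t + 1 := ⟨L - 1, by omega⟩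
  set P := run A (blockAdversary i n A) (t + 1)
  have hW : expect P (pendingWeight n) ≤ 1 := by
    have h := expect_pendingWeight_le (i := i) (n := n) (A := A) t
    have h4 : (4 : ℝ≥0∞) ^ t ≠ 0 := by simp
    have h4' : (4 : ℝ≥0∞) ^ t ≠ ⊤ := by simp
    refine (ENNReal.mul_le_mul_iff_right h4 h4').mp (h.trans ?_)
    rw [mul_one]
    -- Four rounds per targeted mistake suffice, as `3 ^ 4 * 2 = 162 ≤ 256 = 4 ^ 4`.
    have hnat : 3 ^ t * 2 ^ n ≤ 4 ^ t := by
      obtain ⟨s, rfl⟩ : ∃ s, t = 4 * n + s := ⟨t - 4 * n, by omega⟩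
      calc 3 ^ (4 * n + s) * 2 ^ n = (3 ^ 4 * 2) ^ n * 3 ^ s := by
            rw [pow_add, pow_mul, mul_pow]; ring
        _ ≤ (4 ^ 4) ^ n * 4 ^ s :=
            Nat.mul_le_mul (Nat.pow_le_pow_left (by norm_num) _) (Nat.pow_le_pow_left (by norm_num) _)
        _ = 4 ^ (4 * n + s) := by rw [pow_add, pow_mul]
    exact_mod_cast hnat
  have hG := two_mul_add_one_le_expect (i := i) (A := A) hn t
  have hle : 2 * (expect P fun S => ((mistakes S + (n - mistakes S.dropLast) : ℕ) : ℝ≥0∞)) ≤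
      2 * expectedMistakes A (blockAdversary i n A) (t + 1) + expect P (pendingWeight n) := by
    change _ ≤ 2 * expect P (fun S => (mistakes S : ℝ≥0∞)) + _
    rw [← expect_const_mul, ← expect_const_mul, ← expect_add]
    refine expect_mono fun S _ => ?_
    rw [Nat.cast_add, mul_add]
    gcongr
    rw [pendingWeight]
    split_ifs with h
    · obtain ⟨j, hj⟩ : ∃ j, n - mistakes S.dropLast = j + 1 :=
        ⟨n - mistakes S.dropLast - 1, by omega⟩
      have : 2 * (n - mistakes S.dropLast) ≤ 2 ^ (n - mistakes S.dropLast) := by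
        have := Nat.lt_two_pow_self (n := j)
        rw [hj, pow_succ]
        omega
      exact_mod_cast this
    · rw [Nat.sub_eq_zero_of_le (by omega)]
      simp
  have := (hG.trans hle).trans (add_le_add_right hW _)
  have h1 := (ENNReal.add_le_add_iff_right ENNReal.one_ne_top).mp this
  exact (ENNReal.mul_le_mul_iff_right (by norm_num) (by norm_num)).mp h1

end Mistakes

/-! ### Consistency of the adversary -/

theorem countP_eq_card_filter_get {α : Type*} (q : α → Bool) (S : List α) :
    S.countP q = (Finset.univ.filter fun t : Fin S.length => q (S.get t) = true).card := by
  induction S with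
  | nil => simp
  | cons a S ih =>
    have h := Fin.card_filter_univ_succ (n := S.length) (fun t => q ((a :: S).get t) = true)
    refine Eq.trans ?_ h.symm
    rw [List.countP_cons, ih]
    by_cases ha : q a = true <;> simp [ha]

/-- A round in which the feedback reveals a share of the `i`-th block. -/
def IsShareRound (i : ℕ) (r : Round ℕ Bool) : Prop :=
  r.x ∈ block i ∧ r.x' ∈ block i ∧ r.y' ≠ r.y

instance (i : ℕ) : DecidablePred (IsShareRound i) := fun _ => instDecidableAnd

/-- If fewer than `(k + 1) * m` shares are revealed, which are all zero, then at most `k` exceptions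
suffice for consistency with a Shamir teacher. -/
theorem exists_kConsistent {m k i : ℕ} {p : ℕ → ℕ} {b : (i : ℕ) → (ℕ → Bool) → ZMod (p i)}
    (hb : IsEncoding p b) (hi : 2 ≤ i) {S : List (Round ℕ Bool)}
    (hx : ∀ r ∈ S, (r.x = 1 ∧ r.y = true) ∨ r.x ∈ block i)
    (hinj : ∀ t u : Fin S.length, (S.get t).x ∈ block i → (S.get t).x = (S.get u).x → t = u)
    (hφ : ∀ r ∈ S, r.y' ≠ r.y → r.φ = some (zeroFeedback i r.x r.x'))
    (hn : S.countP (fun r => decide (IsShareRound i r)) < (k + 1) * m) :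
    ∃ T ∈ shamirClass m p b, KConsistent k T S := by
  classical
  obtain ⟨hprime, hbig, -⟩ := hb i (by omega)
  have : Fact (p i).Prime := ⟨hprime⟩
  have h1 : 1 ∉ block i := by
    have := Nat.pow_le_pow_right (show 0 < 2 by norm_num) hi
    simp only [block, Finset.mem_Ico]
    omega
  let D : ℕ → Finset (Fin S.length) := fun x' =>
    Finset.univ.filter fun t => IsShareRound i (S.get t) ∧ (S.get t).x' = x'
  -- The explanations whose zero shares would already force the secret to be `0`.
  let B : Finset ℕ := (block i).filter fun x' => m ≤ (D x').card
  have hB : B.card ≤ k := by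
    rw [countP_eq_card_filter_get] at hn
    have hsum : B.card * m ≤ ∑ x' ∈ B, (D x').card := by
      rw [← smul_eq_mul]
      exact Finset.card_nsmul_le_sum _ _ _ fun x' hx' => (Finset.mem_filter.mp hx').2
    have hdisj : ∑ x' ∈ B, (D x').card = (B.biUnion D).card := by
      refine (Finset.card_biUnion fun x₁ _ x₂ _ hne => ?_).symm
      refine Finset.disjoint_left.mpr fun t ht₁ ht₂ => hne ?_
      rw [← (Finset.mem_filter.mp ht₁).2.2, ← (Finset.mem_filter.mp ht₂).2.2]
    have hsub : B.biUnion D ⊆ Finset.univ.filter fun t : Fin S.length =>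
        decide (IsShareRound i (S.get t)) = true := by
      intro t ht
      obtain ⟨x', -, ht⟩ := Finset.mem_biUnion.mp ht
      simpa using (Finset.mem_filter.mp ht).2.1
    have := Finset.card_le_card hsub
    have hlt : B.card * m < (k + 1) * m := by omega
    exact Nat.lt_succ_iff.mp (Nat.lt_of_mul_lt_mul_right hlt)
  -- Examples in `B` get label `0` whatever the adversary said, so their polynomials need not encode
  -- the secret and may be zero.
  let f : ℕ → Bool := fun z =>
    decide (z = 1 ∨ z ∈ block i ∧ z ∉ B ∧ ∃ t : Fin S.length, (S.get t).x = z ∧ (S.get t).y = true)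
  have hf : f ∈ labelings i := ⟨by simp [f], fun x hx hx1 => by simp [f, hx, hx1]⟩
  have hc : ∀ x', ∃ c : Fin m → ZMod (p i), (x' ∈ block i → x' ∉ B → secretPoly c 0 = b i f) ∧
      ∀ t, t ∈ D x' → secretPoly c (shareNode i (p i) (S.get t).x) = 0 := by
    intro x'
    by_cases h : x' ∈ block i ∧ x' ∉ B
    · have hlt : (D x').card < m := by
        by_contra! hle
        exact h.2 (Finset.mem_filter.mpr ⟨h.1, hle⟩)
      obtain ⟨c, hc0, hc⟩ := exists_secretPoly_eq (m := m)
        ((D x').image fun t => shareNode i (p i) (S.get t).x)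
        (Finset.card_image_le.trans_lt hlt) (fun h0 => by
          obtain ⟨t, ht, h0⟩ := Finset.mem_image.mp h0
          exact shareNode_ne_zero hbig (Finset.mem_filter.mp ht).2.1.1 h0) (b i f)
      exact ⟨c, fun _ _ => hc0, fun t ht => hc _ (Finset.mem_image_of_mem _ ht)⟩
    · exact ⟨0, fun h₁ h₂ => absurd ⟨h₁, h₂⟩ h, fun _ _ => secretPoly_zero _⟩
  choose c hc0 hc using hc
  -- Polynomials for the true label `1` carry no constraint, so zero polynomials match the feedback
  -- there.
  let a : ℕ → Bool → Fin m → ZMod (p i) := fun x' y => if y = true then 0 else c x'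
  refine ⟨shamirTeacher i f a, ⟨i, by omega, f, hf, a, fun x' hx' hfx' => ?_, rfl⟩,
    Finset.univ.filter fun t => (S.get t).x ∈ B, ?_, fun t ht => ?_⟩
  · have hx1 : x' ≠ 1 := fun h => h1 (h ▸ hx')
    have hnB : x' ∉ B := by
      rcases of_decide_eq_true hfx' with h | h
      · exact absurd h hx1
      · exact h.2.1
    simpa [a] using hc0 x' hx' hnB
  -- Each example of the block is presented at most once, so each element of `B` costs at most one
  -- exception.
  · refine le_trans (Finset.card_le_card_of_injOn (fun t => (S.get t).x)
      (fun t ht => (Finset.mem_filter.mp ht).2) fun t ht u _ h => hinj t u ?_ h) hB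
    exact (Finset.mem_filter.mp (Finset.mem_filter.mp ht).2).1
  · have hmem := S.get_mem t
    have hnB : (S.get t).x ∉ B := fun h => ht (by simpa using h)
    have hlabel : f (S.get t).x = (S.get t).y := by
      rcases hx _ hmem with ⟨hx1, hy⟩ | hxi
      · rw [hx1, hy]
        exact hf.1
      · have hx1 : (S.get t).x ≠ 1 := fun h => h1 (h ▸ hxi)
        rw [Bool.eq_iff_iff]
        simp only [f, decide_eq_true_eq]
        constructor
        · rintro (h | ⟨-, -, u, hu, hy⟩)
          · exact absurd h hx1
          · rw [hinj t u hxi hu.symm]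
            exact hy
        · exact fun h => Or.inr ⟨hxi, hnB, t, rfl, h⟩
    refine ⟨hlabel, fun hne => ?_⟩
    rw [hφ _ hmem hne]
    refine congrArg some (funext fun z => ?_)
    by_cases hblock : (S.get t).x ∈ block i ∧ (S.get t).x' ∈ block i
    · have hs : share i (a (S.get t).x' (f (S.get t).x)) (S.get t).x = 2 ^ (i + 1) := by
        have h0 : secretPoly (a (S.get t).x' (f (S.get t).x))
            (shareNode i (p i) (S.get t).x) = 0 := by
          by_cases hy : f (S.get t).x = true
          · simp only [a, hy, if_true]
            exact secretPoly_zero _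
          · simp only [a, hy]
            exact hc _ t (Finset.mem_filter.mpr
              ⟨Finset.mem_univ _, ⟨hblock.1, hblock.2, hne⟩, rfl⟩)
        change 2 ^ (i + 1) + (secretPoly _ (shareNode i (p i) (S.get t).x)).val = _
        rw [h0, ZMod.val_zero, add_zero]
      rw [zeroFeedback, if_pos hblock, if_pos hblock, hs]
    · rw [zeroFeedback, if_neg hblock, if_neg hblock]

/-- What the adversary ensures in the first `t` rounds. -/
structure AdversaryInvariant (i n t : ℕ) (S : List (Round ℕ Bool)) : Prop where
  length_eq : S.length = t
  example_mem : ∀ r ∈ S, (r.x = 1 ∧ r.y = true) ∨ (2 ^ i ≤ r.x ∧ r.x < 2 ^ i + t)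
  pairwise_ne : S.Pairwise fun r r' => r.x = r'.x → r.x = 1
  feedback_eq : ∀ r ∈ S, r.y' ≠ r.y → r.φ = some (zeroFeedback i r.x r.x')
  shares_le : S.countP (fun r => decide (IsShareRound i r)) ≤ n
  shares_le_mistakes : S.countP (fun r => decide (IsShareRound i r)) ≤ mistakes S.dropLast

theorem adversaryInvariant_run {i n : ℕ} (hi : 2 ≤ i) {A : Algorithm history} {t : ℕ}
    {S : List (Round ℕ Bool)} (h : S ∈ (run A (blockAdversary i n A) t).support) :
    AdversaryInvariant i n t S := by
  have h4 : 4 ≤ 2 ^ i := Nat.pow_le_pow_right (show 0 < 2 by norm_num) hi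
  induction t generalizing S with
  | zero =>
    rw [run, PMF.mem_support_pure_iff] at h
    subst h
    constructor <;> simp
  | succ t ih =>
    obtain ⟨S, hS, e, he, rfl⟩ := mem_support_run_succ h
    have inv := ih hS
    have hlen := inv.length_eq
    have hfb : (blockAdversary i n A S).2.2 = zeroFeedback i := by
      unfold blockAdversary
      split_ifs <;> rfl
    have hfst : (blockAdversary i n A S).1 = 1 ∧ (blockAdversary i n A S).2.1 = true ∧
        ¬ mistakes S.dropLast < n ∨
        (blockAdversary i n A S).1 = 2 ^ i + t ∧ mistakes S.dropLast < n := by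
      by_cases hlt : mistakes S.dropLast < n
      · exact Or.inr ⟨by rw [blockAdversary_of_lt hlt, hlen], hlt⟩
      · exact Or.inl ⟨by rw [blockAdversary_of_not_lt hlt], by rw [blockAdversary_of_not_lt hlt], hlt⟩
    -- In the first round the explanation is `1` or `2`, both below the block since `2 ≤ i`. After
    -- the target is reached the example is `1`, also outside the block.
    have hshare : IsShareRound i (playRound (blockAdversary i n A S) e) →
        S ≠ [] ∧ mistakes S.dropLast < n ∧ e.2 ≠ (blockAdversary i n A S).2.1 := by
      rintro ⟨hx, hx', hy⟩
      refine ⟨?_, ?_, hy⟩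
      · rintro rfl
        have hx' : e.1 ∈ block i := hx'
        simp only [block, Finset.mem_Ico] at hx'
        rcases A.legal _ _ e he with (rfl | rfl) | ⟨r, hr, -⟩
        · simp only at hx'
          omega
        · simp only at hx'
          omega
        · cases hr
      · rcases hfst with ⟨h1, -⟩ | ⟨-, h⟩
        · have hx : (blockAdversary i n A S).1 ∈ block i := hx
          rw [h1] at hx
          simp only [block, Finset.mem_Ico] at hx
          omega
        · exact h
    set V := blockAdversary i n A S
    refine ⟨by simp [hlen], ?_, ?_, ?_, ?_, ?_⟩
    · intro r hr
      rcases List.mem_cons.mp hr with rfl | hr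
      · rcases hfst with ⟨h1, h2, -⟩ | ⟨h1, -⟩
        · exact Or.inl ⟨h1, h2⟩
        · refine Or.inr ?_
          change 2 ^ i ≤ V.1 ∧ V.1 < _
          omega
      · rcases inv.example_mem r hr with h | h
        · exact Or.inl h
        · exact Or.inr (by omega)
    · refine List.pairwise_cons.mpr ⟨fun r hr hrx => ?_, inv.pairwise_ne⟩
      change V.1 = r.x at hrx
      change V.1 = 1
      rcases inv.example_mem r hr with h | h <;> omega
    · intro r hr hne
      rcases List.mem_cons.mp hr with rfl | hr
      · have hne : e.2 ≠ V.2.1 := hne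
        simp [playRound, hne, hfb]
      · exact inv.feedback_eq r hr hne
    -- A new share appears only while fewer than `n` mistakes follow the first round, and the shares
    -- so far are at most those mistakes.
    · rw [List.countP_cons]
      have h1 := inv.shares_le
      have h2 := inv.shares_le_mistakes
      split_ifs with hr
      · have := hshare (of_decide_eq_true hr)
        omega
      · exact h1
    · rw [List.countP_cons]
      have h2 := inv.shares_le_mistakes
      split_ifs with hr
      · obtain ⟨hne, -, he⟩ := hshare (of_decide_eq_true hr)
        rw [dropLast_cons _ hne, mistakes_cons, if_neg he]
        omega
      · by_cases hne : S = []
        · subst hne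
          simp
        · rw [dropLast_cons _ hne, mistakes_cons]
          omega

theorem blockAdversary_mem_adversaries {m k L i n : ℕ} {p : ℕ → ℕ}
    {b : (i : ℕ) → (ℕ → Bool) → ZMod (p i)} (hb : IsEncoding p b) (hi : 2 ≤ i) (hL : L ≤ 2 ^ i)
    (hn : n < (k + 1) * m) (A : Algorithm history) :
    blockAdversary i n A ∈ adversaries k L A (shamirClass m p b) := by
  intro S hS
  have inv := adversaryInvariant_run hi hS
  refine exists_kConsistent hb hi (fun r hr => (inv.example_mem r hr).imp_right fun h => ?_)
    (fun t u ht htu => ?_) inv.feedback_eq (inv.shares_le.trans_lt hn)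
  · simp only [block, Finset.mem_Ico, pow_succ]
    omega
  · have h1 : (S.get t).x ≠ 1 := by
      have := Nat.pow_le_pow_right (show 0 < 2 by norm_num) hi
      simp only [block, Finset.mem_Ico] at ht
      omega
    have hpw := List.pairwise_iff_get.mp inv.pairwise_ne
    rcases lt_trichotomy t u with h | h | h
    · exact absurd (hpw t u h htu) h1
    · exact h
    · exact absurd (htu.trans (hpw u t h htu.symm)) h1

/-! ## The lower bound -/

theorem le_mistakeBound_shamirClass {m k L : ℕ} {p : ℕ → ℕ}
    {b : (i : ℕ) → (ℕ → Bool) → ZMod (p i)} (hb : IsEncoding p b) (hm : 1 ≤ m) (hk : 1 ≤ k)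
    (hL : 4 * (k + 1) * (m + 1) ≤ L) (A : Algorithm history) :
    (((k + 1) * m - 1 : ℕ) : ℝ≥0∞) ≤ mistakeBound k L A (shamirClass m p b) := by
  have h2 : 2 * 1 ≤ (k + 1) * m := Nat.mul_le_mul (by omega) hm
  have hL' : 4 * ((k + 1) * m) + 4 * (k + 1) ≤ L := by
    calc _ = 4 * (k + 1) * (m + 1) := by ring
      _ ≤ L := hL
  refine le_trans (le_expectedMistakes (i := L) (A := A) (by omega) (by omega))
    (le_iSup₂ (f := fun V (_ : V ∈ adversaries k L A (shamirClass m p b)) =>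
      expectedMistakes A V L) _ ?_)
  -- The block index is `L` itself: its `2 ^ L` examples are enough for `L` rounds.
  exact blockAdversary_mem_adversaries hb (by omega) Nat.lt_two_pow_self.le (by omega) A

/-- A lower bound with slope `d - 1 ≥ 2` in `k` precludes a sublinear regret. -/
theorem exists_linear_regret {d : ℕ} (hd : 3 ≤ d) {𝒯 : Set (Teacher ℕ Bool)}
    (h : ∀ k L : ℕ, 1 ≤ k → 4 * (k + 1) * d ≤ L → ∀ A : Algorithm history,
        ENNReal.ofReal (((k : ℝ) + 1) * d - k - 2) ≤ mistakeBound k L A 𝒯) :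
    ∃ c : ℝ, 0 < c ∧ ∀ᶠ L : ℕ in atTop, ∃ k : ℕ, ∀ A : Algorithm history,
      ENNReal.ofReal (k + c * L) ≤ mistakeBound k L A 𝒯 := by
  have hd' : (3 : ℝ) ≤ d := by exact_mod_cast hd
  -- With `L / (4 * d) = k + 2` and `k + 1` exceptions, the bound exceeds the number of exceptions
  -- by at least `k + 2`, because `d ≥ 3`, while `L / (8 * d) ≤ (k + 3) / 2`.
  refine ⟨1 / (8 * d), by positivity, ?_⟩
  filter_upwards [eventually_ge_atTop (8 * d)] with L hL
  have hpos : 0 < 4 * d := by omega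
  obtain ⟨k, hk⟩ : ∃ k, L / (4 * d) = k + 2 := by
    have : 2 ≤ L / (4 * d) := (Nat.le_div_iff_mul_le hpos).mpr (by omega)
    exact ⟨L / (4 * d) - 2, by omega⟩
  refine ⟨k + 1, fun A => le_trans (ENNReal.ofReal_le_ofReal ?_) (h (k + 1) L (by omega) ?_ A)⟩
  · have hlt : L < (k + 2 + 1) * (4 * d) := by
      rw [← hk]
      exact Nat.lt_mul_of_div_lt (Nat.lt_succ_self _) hpos
    have hlt' : (L : ℝ) ≤ (k + 3) * (4 * d) := by
      have : (L : ℝ) ≤ ((k + 2 + 1) * (4 * d) : ℕ) := by exact_mod_cast hlt.le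
      push_cast at this
      linarith
    have hc : 1 / (8 * (d : ℝ)) * L ≤ (k + 3) / 2 := by
      rw [div_mul_eq_mul_div, one_mul, div_le_iff₀ (by positivity)]
      linarith
    push_cast
    nlinarith [mul_nonneg (show (0 : ℝ) ≤ k by positivity) (sub_nonneg.mpr hd')]
  · have := Nat.div_mul_le_self L (4 * d)
    rw [hk] at this
    calc 4 * (k + 1 + 1) * d = (k + 2) * (4 * d) := by ring
      _ ≤ L := this

theorem not_isNoRegret_of_linear_regret {𝒯 : Set (Teacher ℕ Bool)} {c : ℝ} (hc : 0 < c)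
    (h : ∀ᶠ L : ℕ in atTop, ∃ k : ℕ, ∀ A : Algorithm history,
      ENNReal.ofReal (k + c * L) ≤ mistakeBound k L A 𝒯)
    (A : ℕ → ℕ → Algorithm history) : ¬ IsNoRegret A 𝒯 := by
  intro hA
  obtain ⟨L, ⟨k, hk⟩, hL, hpos⟩ :=
    (h.and ((hA (c / 2) (by positivity)).and (eventually_gt_atTop 0))).exists
  have hle := (hk (A L k)).trans (hL k)
  have hpos' : (0 : ℝ) < L := by exact_mod_cast hpos
  rw [ENNReal.ofReal_le_ofReal_iff (by positivity)] at hle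
  nlinarith

end DFF

theorem theorem9 (d : ℕ) (hd : 2 ≤ d) :
    ∃ 𝒯 : Set (DFF.Teacher ℕ Bool),
      DFF.IsShamirClass (d - 1) 𝒯 ∧
      (DFF.consistentTeachers 𝒯 DFF.history).Nonempty ∧
      DFF.DFFdim 𝒯 DFF.history ≤ d ∧
      (∀ k L : ℕ, 1 ≤ k → 4 * (k + 1) * d ≤ L → ∀ A : DFF.Algorithm DFF.history,
        ENNReal.ofReal (((k : ℝ) + 1) * d - k - 2) ≤ DFF.mistakeBound k L A 𝒯) ∧
      (3 ≤ d →
        (∃ c : ℝ, 0 < c ∧ ∀ᶠ L : ℕ in Filter.atTop, ∃ k : ℕ, ∀ A : DFF.Algorithm DFF.history,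
          ENNReal.ofReal (k + c * L) ≤ DFF.mistakeBound k L A 𝒯) ∧
        ¬ ∃ A : ℕ → ℕ → DFF.Algorithm DFF.history, DFF.IsNoRegret A 𝒯) := by
  obtain ⟨p, b, hb⟩ := DFF.exists_isEncoding
  obtain ⟨m, rfl⟩ : ∃ m, d = m + 1 := ⟨d - 1, by omega⟩
  have hbound : ∀ k L : ℕ, 1 ≤ k → 4 * (k + 1) * (m + 1) ≤ L →
      ∀ A : DFF.Algorithm DFF.history, ENNReal.ofReal (((k : ℝ) + 1) * (m + 1 : ℕ) - k - 2) ≤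
        DFF.mistakeBound k L A (DFF.shamirClass m p b) := by
    intro k L hk hL A
    refine le_trans (le_of_eq ?_) (DFF.le_mistakeBound_shamirClass hb (by omega) hk hL A)
    rw [← ENNReal.ofReal_natCast, Nat.cast_sub (Nat.mul_pos (by omega) (by omega))]
    congr 1
    push_cast
    ring
  refine ⟨DFF.shamirClass m p b, ⟨p, b, hb, rfl⟩, DFF.consistentTeachers_shamirClass_nonempty,
    DFF.DFFdim_shamirClass_le hb, hbound, fun hd3 => ?_⟩
  obtain ⟨c, hc, hlin⟩ := DFF.exists_linear_regret hd3 hbound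
  exact ⟨⟨c, hc, hlin⟩, fun ⟨A, hA⟩ => DFF.not_isNoRegret_of_linear_regret hc hlin A hA⟩
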